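/- For a structure $\mathcal{K}$ with universe $K$ and $A\subseteq K$, let $\mathrm{dcl}(A)$ be the set of all $a\in K$ such that $\{a\}$ is definable in $\mathcal{K}$ by a first-order formula with parameters from $A$. Let $\deg^{\exists\text{-synt}}_{\mathrm{rig}}(\mathcal{K})\in\omega\cup\{\infty\}$ be the least $n\in\omega$ such that $K=\mathrm{dcl}(A)$ for some $A\subseteq K$ with $|A|=n$, and $\infty$ if there is no such $n$. Let $\mathcal{M}$ and $\mathcal{N}$ be nonempty structures of relational languages $\Sigma_{\mathcal{M}}$ and $\Sigma_{\mathcal{N}}$, which may have common symbols. The composition $\mathcal{M}[\mathcal{N}]$ is the structure of the language $\Sigma_{\mathcal{M}}\cup\Sigma_{\mathcal{N}}$ with universe $M\times N$ in which an $n$-ary symbol $R$ holds at $((a_1,b_1),\ldots,(a_n,b_n))$ iff $R\in\Sigma_{\mathcal{M}}$ and $(a_1,\ldots,a_n)\in R_{\mathcal{M}}$, or $R\in\Sigma_{\mathcal{N}}$, $a_1=\ldots=a_n$ and $(b_1,\ldots,b_n)\in R_{\mathcal{N}}$. It is called $E$-definable if it has an $\emptyset$-definable equivalence relation $E$ whose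 classes are exactly the sets $\{a\}\times N$, $a\in M$, and these classes are copies of $\mathcal{N}$, i.e. for every $a\in M$ the map $b\mapsto(a,b)$ preserves and reflects all relations of $\Sigma_{\mathcal{N}}$. Theorem. Let $\mathcal{M}[\mathcal{N}]$ be an $E$-definable composition. (1) Suppose that $N=\mathrm{dcl}(\emptyset)$ in $\mathcal{N}$, and that each symbol $R\in\Sigma_{\mathcal{M}}\cap\Sigma_{\mathcal{N}}$ (if there are any) holds in $\mathcal{M}$ at all constant tuples $(a,\ldots,a)$, $a\in M$, or at none of them. Then $$\deg^{\exists\text{-synt}}_{\mathrm{rig}}(\mathcal{M}[\mathcal{N}])=\deg^{\exists\text{-synt}}_{\mathrm{rig}}(\mathcal{M}).$$ In particular, $\deg^{\exists\text{-synt}}_{\mathrm{rig}}(\mathcal{M}[\mathcal{N}])$ is finite iff $\deg^{\exists\text{-synt}}_{\mathrm{rig}}(\mathcal{M})$ is finite. (2) If $N\neq\mathrm{dcl}(\emptyset)$ in $\mathcal{N}$, then $$\deg^{\exists\text{-synt}}_{\mathrm{rig}}(\mathcal{M}[\mathcal{N}])=|M|\cdot\deg^{\exists\text{-synt}}_{\mathrm{rig}}(\mathcal{N}),$$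 where $|M|=\infty$ if $M$ is infinite. In particular, $\deg^{\exists\text{-synt}}_{\mathrm{rig}}(\mathcal{M}[\mathcal{N}])$ is finite iff $\deg^{\exists\text{-synt}}_{\mathrm{rig}}(\mathcal{N})$ and $M$ are finite. -/

import Mathlib

open Set

universe u v w

namespace Rigidity

/-- The definable closure of `A`: the elements `a` such that `{a}` is the solution set of a
first-order formula with parameters from `A`. -/
def dcl (L : FirstOrder.Language.{u, v}) {M : Type w} [L.Structure M] (A : Set M) : Set M :=
  {a | A.Definable₁ L {a}}

/-- Syntactic `A`-rigidity: the whole universe is the definable closure of `A`. -/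
def SyntRigidOver (L : FirstOrder.Language.{u, v}) {M : Type w} [L.Structure M] (A : Set M) : Prop :=
  dcl L A = univ

/-- `∃`-syntactic `n`-rigidity: syntactic `A`-rigidity for some `A` with exactly `n` elements. -/
def ExistsSyntRigid (L : FirstOrder.Language.{u, v}) (M : Type w) [L.Structure M] (n : ℕ) : Prop :=
  ∃ A : Set M, A.encard = n ∧ SyntRigidOver L A

/-- The `∃`-syntactic degree of rigidity: the least natural number `n` such that the structure is
`∃`-syntactically `n`-rigid, and `⊤` if there is no such `n`. -/
noncomputable def degExistsSynt (L : FirstOrder.Language.{u, v}) (M : Type w) [L.Structure M] : ℕ∞ :=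
  sInf {k : ℕ∞ | ∃ n : ℕ, k = n ∧ ExistsSyntRigid L M n}

/-- The relational language whose `n`-ary symbols are the elements of `Sg n`. Languages which may
share symbols are given as subfamilies of one family `S` of symbols, graded by arity. -/
def relLang {S : ℕ → Type u} (Sg : ∀ n, Set (S n)) : FirstOrder.Language.{0, u} :=
  ⟨fun _ => Empty, fun n => Sg n⟩

/-- The symbols of the union of two relational languages. -/
def unionSymb {S : ℕ → Type u} (SM SN : ∀ n, Set (S n)) : ∀ n, Set (S n) :=
  fun n => SM n ∪ SN n

section Composition

variable {S : ℕ → Type u} (SM SN : ∀ n, Set (S n)) (M : Type v) (N : Type w)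
  [(relLang SM).Structure M] [(relLang SN).Structure N]

/-- The interpretation of the symbol `R : S n` of the language `Sg` in `X`, and the empty relation
if `R` does not belong to `Sg`. -/
def rel {S : ℕ → Type u} (Sg : ∀ n, Set (S n)) {X : Type v} [(relLang Sg).Structure X]
    {n : ℕ} (R : S n) (x : Fin n → X) : Prop :=
  ∃ h : R ∈ Sg n,
    FirstOrder.Language.Structure.RelMap (L := relLang Sg) (M := X) (n := n) ⟨R, h⟩ x

/-- The composition `M[N]`, on the universe `M × N`. A symbol `R` holds at
`((a₁, b₁), …, (aₙ, bₙ))` iff `R` is a symbol of `M` and holds at `(a₁, …, aₙ)`, or `R` is a symbol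
of `N`, `a₁ = … = aₙ` and `R` holds at `(b₁, …, bₙ)`. -/
instance compStructure : (relLang (unionSymb SM SN)).Structure (M × N) where
  funMap := fun f => Empty.elim f
  RelMap := fun R x =>
    rel SM R.1 (fun i => (x i).1) ∨
      ((∀ i j, (x i).1 = (x j).1) ∧ rel SN R.1 (fun i => (x i).2))

/-- The composition `M[N]` is `E`-definable: it has an `∅`-definable equivalence relation whose
classes are the sets `{a} × N`, and these carry copies of `N`, that is, for each `a` the bijection
`b ↦ (a, b)` from `N` onto `{a} × N` preserves and reflects all relations of the language
of `N`. -/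
def IsEDefinableComposition : Prop :=
  (∃ E : Setoid (M × N),
    (∅ : Set (M × N)).Definable₂ (relLang (unionSymb SM SN)) {p | E p.1 p.2} ∧
    E.classes = range fun a : M => {p : M × N | p.1 = a}) ∧
  ∀ (a : M) (n : ℕ) (R : S n), R ∈ SN n → ∀ b : Fin n → N,
    (rel (unionSymb SM SN) R (fun i => (a, b i)) ↔ rel SN R b)

/-- Every symbol common to both languages holds in `M` either at all constant tuples
`(a, …, a)` or at none of them. -/
def SharedSymbolsDiagonal : Prop :=
  ∀ (n : ℕ) (R : S n), R ∈ SM n → R ∈ SN n →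
    (∀ a : M, rel SM R (fun _ : Fin n => a)) ∨ (∀ a : M, ¬ rel SM R (fun _ : Fin n => a))

end Composition

end Rigidity

namespace Rigidity

open FirstOrder FirstOrder.Language

/-! ### Definable sets, substitution of parameters, definable closure -/

section Definability

variable {L : FirstOrder.Language.{u, v}} {K : Type w} [L.Structure K] {α : Type*} {n : ℕ}

/-! Each degree is bounded from both sides by moving generating sets between
$\mathcal{M}[\mathcal{N}]$ and its factors, which requires translating formulas in both directions.

From a factor to the composition the translation is an interpretation. Formulas of $\mathcal{M}$ are
read through first coordinates, with equality read as $E$; formulas of $\mathcal{N}$ are read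
through second coordinates, with quantifiers relativized to the $E$-class of a chosen variable
(`exists_definable_pullback`). Hence if $N=\mathrm{dcl}(\emptyset)$ and $A$ generates $\mathcal{M}$,
then $A\times\{c\}$ generates the composition; and if a nonempty $A$ generates $\mathcal{N}$, so
does $M\times A$, since its points also name the classes.

From the composition to a factor, freeze part of each variable. With second coordinates frozen, or
with everything frozen outside one class $\{a\}\times N$, an atomic formula becomes one of finitely
many definable relations on the factor. Finiteness survives the connectives and quantifiers
(`finDefFamily_realize`), so every formula becomes definable in the factor. Hence if $A$ generates
the composition, its projection generates $\mathcal{M}$ (`dcl_image_fst`) and each fiber generates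
$\mathcal{N}$ (`dcl_fiber_snd`). In (2) the fibers are disjoint and nonempty, which gives the
product. -/

theorem definable_exists_snoc {A : Set K} {s : Set (α ⊕ Fin (n + 1) → K)} (hs : A.Definable L s) :
    A.Definable L
      {x : α ⊕ Fin n → K | ∃ y, Sum.elim (x ∘ Sum.inl) (Fin.snoc (x ∘ Sum.inr) y) ∈ s} := by
  let e : α ⊕ Fin (n + 1) → (α ⊕ Fin n) ⊕ Fin 1 :=
    Sum.elim (fun i => Sum.inl (Sum.inl i)) (Fin.snoc (fun i => Sum.inl (Sum.inr i)) (Sum.inr 0))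
  have key : ∀ (x : α ⊕ Fin n → K) (u : Fin 1 → K),
      Sum.elim x u ∘ e = Sum.elim (x ∘ Sum.inl) (Fin.snoc (x ∘ Sum.inr) (u 0)) := by
    intro x u
    funext i
    rcases i with i | i
    · rfl
    · refine Fin.lastCases ?_ (fun i => ?_) i <;> simp [e]
  convert (hs.preimage_comp e).exists_of_finite using 1
  ext x
  simp only [mem_ofPred_eq, mem_preimage, key]
  exact ⟨fun ⟨y, hy⟩ => ⟨fun _ => y, hy⟩, fun ⟨u, hu⟩ => ⟨u 0, hu⟩⟩

theorem definable_eq (A : Set K) (i j : α) : A.Definable L {x : α → K | x i = x j} :=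
  ⟨(Term.var i).equal (Term.var j), by ext x; simp⟩

theorem definable_relMap (R : L.Relations n) :
    (∅ : Set K).Definable L {x : Fin n → K | Structure.RelMap R x} :=
  empty_definable_iff.2 ⟨R.formula Term.var, by ext x; simp⟩

/-- Substituting parameters for some of the variables of an `∅`-definable relation. -/
theorem definable_subst {β : Type*} {s : Set (α → K)} (hs : (∅ : Set K).Definable L s) {A : Set K}
    (g : α → A ⊕ β) : A.Definable L {y : β → K | Sum.elim (fun p : A => (p : K)) y ∘ g ∈ s} := by
  obtain ⟨φ, rfl⟩ := empty_definable_iff.1 hs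
  exact definable_iff_exists_formula_sum.2 ⟨φ.relabel g, by ext y; simp [Formula.realize_relabel]⟩

theorem mem_dcl_of_definable {A : Set K} {a : K} {s : Set (Fin 1 → K)} (hs : A.Definable L s)
    (h : ∀ y, y ∈ s ↔ y 0 = a) : a ∈ dcl L A :=
  (congrArg (Set.Definable A L) (Set.ext h)).mp hs

theorem mem_dcl_iff {A : Set K} {a : K} :
    a ∈ dcl L A ↔ ∃ s : Set (A ⊕ Fin 1 → K), (∅ : Set K).Definable L s ∧
      ∀ y : Fin 1 → K, Sum.elim (fun p : A => (p : K)) y ∈ s ↔ y 0 = a := by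
  constructor
  · intro h
    obtain ⟨φ, hφ⟩ := definable_iff_exists_formula_sum.1 h
    refine ⟨{x | φ.Realize x}, empty_definable_iff.2 ⟨φ, rfl⟩, fun y => ?_⟩
    exact (Set.ext_iff.1 hφ y).symm
  · rintro ⟨s, hs, h⟩
    exact mem_dcl_of_definable (definable_subst hs id) h


theorem terms_eq_var [L.IsRelational] {β : Type*} (t : L.Term β) : ∃ i, t = Term.var i := by
  cases t with
  | var i => exact ⟨i, rfl⟩
  | func f _ => exact isEmptyElim f

end Definability

/-! ### Interpretations: formulas of a factor pulled back to the composition -/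

section Interpretation

variable {L : FirstOrder.Language.{u, v}} {L' : FirstOrder.Language.{u, v}} [L'.IsRelational]
  {K : Type*} {K' : Type*} [L.Structure K] [L'.Structure K'] (f : K → K') (dom : K → K → Prop)

/-- Pulling back formulas along an interpretation whose domain `dom z` depends on a variable. -/
theorem exists_definable_pullback
    (hdom : (∅ : Set K).Definable₂ L {p | dom p.1 p.2})
    (hf : ∀ z y, ∃ x, dom z x ∧ f x = y)
    (heq : ∃ s : Set (Fin 2 → K), (∅ : Set K).Definable L s ∧
      ∀ z x, (∀ i, dom z (x i)) → (x ∈ s ↔ f (x 0) = f (x 1)))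
    (hrel : ∀ (n : ℕ) (R : L'.Relations n), ∃ s : Set (Fin n → K), (∅ : Set K).Definable L s ∧
      ∀ z x, (∀ i, dom z (x i)) → (x ∈ s ↔ Structure.RelMap R (f ∘ x)))
    {β : Type*} (z : β) {n : ℕ} (φ : L'.BoundedFormula β n) :
    ∃ s : Set (β ⊕ Fin n → K), (∅ : Set K).Definable L s ∧
      ∀ x, (∀ i, dom (x (Sum.inl z)) (x i)) →
        (x ∈ s ↔ φ.Realize (f ∘ x ∘ Sum.inl) (f ∘ x ∘ Sum.inr)) := by
  induction φ with
  | falsum => exact ⟨∅, definable_empty, fun x _ => by simp [BoundedFormula.Realize]⟩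
  | equal t₁ t₂ =>
    obtain ⟨i, rfl⟩ := terms_eq_var t₁
    obtain ⟨j, rfl⟩ := terms_eq_var t₂
    obtain ⟨s, hs, h⟩ := heq
    refine ⟨_, hs.preimage_comp ![i, j], fun x hx => ?_⟩
    rw [mem_preimage, h (x (Sum.inl z)) (x ∘ _) (fun k => hx _)]
    rcases i with i | i <;> rcases j with j | j <;> simp [BoundedFormula.Realize]
  | rel R ts =>
    choose t ht using fun i => terms_eq_var (ts i)
    obtain ⟨s, hs, h⟩ := hrel _ R
    refine ⟨_, hs.preimage_comp t, fun x hx => ?_⟩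
    rw [mem_preimage, h (x (Sum.inl z)) (x ∘ _) (fun k => hx _)]
    simp only [BoundedFormula.Realize, ht]
    refine iff_of_eq (congrArg _ (funext fun k => ?_))
    rcases hk : t k with i | i <;> simp [hk]
  | imp φ ψ ihφ ihψ =>
    obtain ⟨s, hs, h⟩ := ihφ
    obtain ⟨t, ht, h'⟩ := ihψ
    refine ⟨sᶜ ∪ t, hs.compl.union ht, fun x hx => ?_⟩
    rw [BoundedFormula.realize_imp, ← h x hx, ← h' x hx, mem_union, mem_compl_iff, imp_iff_not_or]
  | all φ ih =>
    rename_i n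
    obtain ⟨s, hs, h⟩ := ih
    have hd := hdom.preimage_comp
      (![Sum.inl z, Sum.inr (Fin.last n)] : Fin 2 → β ⊕ Fin (n + 1))
    -- The universal quantifier becomes "no counterexample inside `dom z`"; the guard keeps the
    -- extended tuple in the domain, where the induction hypothesis applies.
    refine ⟨_, (definable_exists_snoc (hd.inter hs.compl)).compl, fun x hx => ?_⟩
    have hreal : ∀ y, dom (x (Sum.inl z)) y →
        (Sum.elim (x ∘ Sum.inl) (Fin.snoc (x ∘ Sum.inr) y) ∈ s ↔
          φ.Realize (f ∘ x ∘ Sum.inl) (Fin.snoc (f ∘ x ∘ Sum.inr) (f y))) := by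
      intro y hy
      rw [h]
      · simp only [Sum.elim_comp_inl, Sum.elim_comp_inr, Fin.comp_snoc]
      · rintro (i | i)
        · exact hx _
        · refine Fin.lastCases ?_ (fun i => ?_) i
          · simpa using hy
          · simpa using hx (Sum.inr i)
    simp only [mem_compl_iff, mem_ofPred_eq, mem_inter_iff, mem_preimage, not_exists, not_and,
      not_not, BoundedFormula.realize_all]
    constructor
    · intro H y'
      obtain ⟨y, hy, rfl⟩ := hf (x (Sum.inl z)) y'
      exact (hreal y hy).1 (H y (by simpa using hy))
    · intro H y hy
      have hy : dom (x (Sum.inl z)) y := by simpa using hy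
      exact (hreal y hy).2 (H _)

theorem exists_definable_pullback_set
    (hdom : (∅ : Set K).Definable₂ L {p | dom p.1 p.2})
    (hf : ∀ z y, ∃ x, dom z x ∧ f x = y)
    (heq : ∃ s : Set (Fin 2 → K), (∅ : Set K).Definable L s ∧
      ∀ z x, (∀ i, dom z (x i)) → (x ∈ s ↔ f (x 0) = f (x 1)))
    (hrel : ∀ (n : ℕ) (R : L'.Relations n), ∃ s : Set (Fin n → K), (∅ : Set K).Definable L s ∧
      ∀ z x, (∀ i, dom z (x i)) → (x ∈ s ↔ Structure.RelMap R (f ∘ x)))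
    {β : Type*} (z : β) {t : Set (β → K')} (ht : (∅ : Set K').Definable L' t) :
    ∃ s : Set (β → K), (∅ : Set K).Definable L s ∧
      ∀ x, (∀ i, dom (x z) (x i)) → (x ∈ s ↔ f ∘ x ∈ t) := by
  obtain ⟨φ, rfl⟩ := empty_definable_iff.1 ht
  obtain ⟨s, hs, h⟩ := exists_definable_pullback f dom hdom hf heq hrel z φ
  refine ⟨_, hs.preimage_comp (Sum.elim id (fun _ => z) : β ⊕ Fin 0 → β), fun x hx => ?_⟩
  rw [mem_preimage, h _ (fun i => hx _), mem_ofPred_eq, Formula.Realize]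
  exact iff_of_eq (congrArg₂ _ rfl (Subsingleton.elim _ _))

end Interpretation

/-! ### Families with finitely many definable members -/

section FiniteFamily

variable {L' : FirstOrder.Language.{u, v}} {K' : Type*} [L'.Structure K'] {ι : Type*} {β : Type*}

/-- A family of `∅`-definable sets with only finitely many distinct members. -/
def FinDefFamily (L' : FirstOrder.Language.{u, v}) {K' : Type*} [L'.Structure K']
    {ι : Type*} {β : Type*} (F : ι → Set (β → K')) : Prop :=
  (range F).Finite ∧ ∀ i, (∅ : Set K').Definable L' (F i)

theorem FinDefFamily.compl {F : ι → Set (β → K')} (hF : FinDefFamily L' F) :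
    FinDefFamily L' fun i => (F i)ᶜ :=
  ⟨(hF.1.image fun s => sᶜ).subset (by rintro _ ⟨i, rfl⟩; exact ⟨_, ⟨i, rfl⟩, rfl⟩),
    fun i => (hF.2 i).compl⟩

theorem FinDefFamily.union {F G : ι → Set (β → K')} (hF : FinDefFamily L' F)
    (hG : FinDefFamily L' G) : FinDefFamily L' fun i => F i ∪ G i :=
  ⟨(hF.1.image2 (· ∪ ·) hG.1).subset (by
      rintro _ ⟨i, rfl⟩; exact ⟨_, ⟨i, rfl⟩, _, ⟨i, rfl⟩, rfl⟩),
    fun i => (hF.2 i).union (hG.2 i)⟩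

theorem FinDefFamily.reindex {κ γ : Type*} {F : ι → Set (β → K')} (hF : FinDefFamily L' F)
    (e : κ → ι) (g : β → γ) :
    FinDefFamily L' fun k => (fun x : γ → K' => x ∘ g) ⁻¹' F (e k) :=
  ⟨(hF.1.image (preimage fun x : γ → K' => x ∘ g)).subset (by
      rintro _ ⟨k, rfl⟩; exact ⟨_, ⟨e k, rfl⟩, rfl⟩),
    fun k => (hF.2 (e k)).preimage_comp g⟩

theorem FinDefFamily.exists_snoc {α : Type*} {n : ℕ} {F : ι → Set (α ⊕ Fin (n + 1) → K')}
    (hF : FinDefFamily L' F) : FinDefFamily L' fun i =>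
      {x : α ⊕ Fin n → K' | ∃ y, Sum.elim (x ∘ Sum.inl) (Fin.snoc (x ∘ Sum.inr) y) ∈ F i} :=
  ⟨(hF.1.image fun s => {x : α ⊕ Fin n → K' |
      ∃ y, Sum.elim (x ∘ Sum.inl) (Fin.snoc (x ∘ Sum.inr) y) ∈ s}).subset (by
      rintro _ ⟨i, rfl⟩; exact ⟨_, ⟨i, rfl⟩, rfl⟩),
    fun i => definable_exists_snoc (hF.2 i)⟩

/-- A union over a possibly infinite `Θ` depends only on which of the finitely many members occur.
So it is a finite union, and only finitely many such unions exist. -/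
theorem FinDefFamily.iUnion {κ Θ : Type*} {F : ι → Set (β → K')} (hF : FinDefFamily L' F)
    (e : κ → Θ → ι) : FinDefFamily L' fun k => ⋃ θ, F (e k θ) := by
  constructor
  · refine (hF.1.finite_subsets.image sUnion).subset ?_
    rintro _ ⟨k, rfl⟩
    refine ⟨range fun θ => F (e k θ), ?_, sUnion_range _⟩
    rintro _ ⟨θ, rfl⟩
    exact ⟨_, rfl⟩
  · intro k
    have hfin : (range fun θ => F (e k θ)).Finite :=
      hF.1.subset (by rintro _ ⟨θ, rfl⟩; exact ⟨_, rfl⟩)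
    have := hfin.to_subtype
    show (∅ : Set K').Definable L' (⋃ θ, F (e k θ))
    rw [← sUnion_range, sUnion_eq_iUnion]
    refine definable_iUnion_of_finite ?_
    rintro ⟨_, θ, rfl⟩
    exact hF.2 _

end FiniteFamily

/-! ### Freezing coordinates: formulas of the composition traced on a factor -/

section Fibers

variable {L : FirstOrder.Language.{u, v}} {L' : FirstOrder.Language.{u, v}} [L.IsRelational]
  {K : Type*} {K' : Type*} [L.Structure K] [L'.Structure K'] {Θ : Type*} (T : Θ → K' → K)

/-- If `K` is covered by maps `T θ : K' → K` and the atomic formulas of `K` pull back to finitely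
many `∅`-definable relations of `K'`, then so do all formulas of `K`. -/
theorem finDefFamily_realize (hT : ∀ x, ∃ θ y, T θ y = x)
    (heq : FinDefFamily L' fun θ : Fin 2 → Θ => {y : Fin 2 → K' | T (θ 0) (y 0) = T (θ 1) (y 1)})
    (hrel : ∀ (n : ℕ) (R : L.Relations n), FinDefFamily L' fun θ : Fin n → Θ =>
      {y : Fin n → K' | Structure.RelMap R fun i => T (θ i) (y i)})
    {β : Type*} {n : ℕ} (φ : L.BoundedFormula β n) :
    FinDefFamily L' fun θ : β ⊕ Fin n → Θ => {y : β ⊕ Fin n → K' |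
      φ.Realize (fun i => T (θ (Sum.inl i)) (y (Sum.inl i)))
        (fun i => T (θ (Sum.inr i)) (y (Sum.inr i)))} := by
  induction φ with
  | falsum =>
    refine ⟨(finite_singleton ∅).subset ?_, fun θ => ?_⟩
    · rintro _ ⟨θ, rfl⟩
      rfl
    · exact definable_empty
  | equal t₁ t₂ =>
    obtain ⟨i, rfl⟩ := terms_eq_var t₁
    obtain ⟨j, rfl⟩ := terms_eq_var t₂
    convert heq.reindex (fun θ => θ ∘ ![i, j]) ![i, j] using 3 with θ
    ext y
    rcases i with i | i <;> rcases j with j | j <;> simp [BoundedFormula.Realize]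
  | rel R ts =>
    choose t ht using fun i => terms_eq_var (ts i)
    convert (hrel _ R).reindex (fun θ => θ ∘ t) t using 3 with θ
    ext y
    simp only [BoundedFormula.Realize, ht, mem_ofPred_eq, mem_preimage]
    refine iff_of_eq (congrArg (Structure.RelMap R) (funext fun k => ?_))
    rcases hk : t k with i | i <;> simp [hk]
  | imp φ ψ ihφ ihψ =>
    convert ihφ.compl.union ihψ using 3 with θ
    ext y
    simp [imp_iff_not_or]
  | all φ ih =>
    rename_i n
    -- Quantifying over `K` means quantifying over a frozen part in `Θ` and a moving part in `K'`;
    -- the former is a union over `Θ`.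
    convert (ih.compl.exists_snoc.iUnion (fun (θ : β ⊕ Fin n → Θ) (θ' : Θ) =>
      Sum.elim (θ ∘ Sum.inl) (Fin.snoc (θ ∘ Sum.inr) θ' : Fin (n + 1) → Θ))).compl using 3 with θ
    ext y
    simp only [mem_compl_iff, mem_ofPred_eq, mem_iUnion, not_exists, not_not,
      BoundedFormula.realize_all, Sum.elim_inl, Sum.elim_inr, Function.comp_apply]
    have key : ∀ θ' y', (fun i : Fin (n + 1) =>
        T ((Fin.snoc (θ ∘ Sum.inr) θ' : Fin (n + 1) → Θ) i)
          ((Fin.snoc (y ∘ Sum.inr) y' : Fin (n + 1) → K') i)) =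
        Fin.snoc (fun i => T (θ (Sum.inr i)) (y (Sum.inr i))) (T θ' y') := by
      intro θ' y'
      funext i
      refine Fin.lastCases ?_ (fun i => ?_) i <;> simp
    simp only [key]
    constructor
    · exact fun H θ' y' => H _
    · intro H x
      obtain ⟨θ', y', rfl⟩ := hT x
      exact H θ' y'

theorem definable_fiber (hT : ∀ x, ∃ θ y, T θ y = x)
    (heq : FinDefFamily L' fun θ : Fin 2 → Θ => {y : Fin 2 → K' | T (θ 0) (y 0) = T (θ 1) (y 1)})
    (hrel : ∀ (n : ℕ) (R : L.Relations n), FinDefFamily L' fun θ : Fin n → Θ =>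
      {y : Fin n → K' | Structure.RelMap R fun i => T (θ i) (y i)})
    {β : Type*} {s : Set (β → K)} (hs : (∅ : Set K).Definable L s) (θ : β → Θ) :
    (∅ : Set K').Definable L' {y : β → K' | (fun i => T (θ i) (y i)) ∈ s} := by
  obtain ⟨φ, rfl⟩ := empty_definable_iff.1 hs
  have h := (finDefFamily_realize T hT heq hrel φ).2 (Sum.elim θ fun i => i.elim0)
  have h' := empty_definable_iff.1 h
  obtain ⟨ψ, hψ⟩ := h'
  refine empty_definable_iff.2 ⟨ψ.relabel (Equiv.sumEmpty β (Fin 0)), ?_⟩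
  ext y
  have := Set.ext_iff.1 hψ (y ∘ Equiv.sumEmpty β (Fin 0))
  simp only [mem_ofPred_eq, Formula.realize_relabel] at this ⊢
  rw [← this, Formula.Realize]
  exact iff_of_eq (congrArg₂ _ rfl (Subsingleton.elim _ _))

end Fibers

instance isRelational_relLang {S : ℕ → Type u} (Sg : ∀ n, Set (S n)) : (relLang Sg).IsRelational :=
  fun _ => inferInstanceAs (IsEmpty Empty)

theorem FinDefFamily.of_mem {L : FirstOrder.Language.{u, v}} {K : Type*} [L.Structure K]
    {ι β : Type*} {F : ι → Set (β → K)} {G : Set (Set (β → K))} (hG : G.Finite)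
    (hdef : ∀ s ∈ G, (∅ : Set K).Definable L s) (hF : ∀ i, F i ∈ G) : FinDefFamily L F :=
  ⟨hG.subset (range_subset_iff.2 hF), fun i => hdef _ (hF i)⟩

/-! ### The degree as a minimum over generating sets -/

section Degree

variable {L : FirstOrder.Language.{u, v}} {M : Type w} [L.Structure M]

theorem degExistsSynt_le_encard {A : Set M} (hA : dcl L A = univ) :
    degExistsSynt L M ≤ A.encard := by
  rcases eq_or_ne A.encard ⊤ with h | h
  · rw [h]; exact le_top
  · obtain ⟨n, hn⟩ := ENat.ne_top_iff_exists.1 h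
    exact sInf_le ⟨n, hn.symm, A, hn.symm, hA⟩

theorem le_degExistsSynt {c : ℕ∞} (h : ∀ A : Set M, A.Finite → dcl L A = univ → c ≤ A.encard) :
    c ≤ degExistsSynt L M := by
  refine le_sInf ?_
  rintro _ ⟨n, rfl, A, hn, hA⟩
  exact hn ▸ h A (finite_of_encard_eq_coe hn) hA

theorem exists_encard_eq_degExistsSynt (h : degExistsSynt L M ≠ ⊤) :
    ∃ A : Set M, A.encard = degExistsSynt L M ∧ dcl L A = univ := by
  have hne : {k : ℕ∞ | ∃ n : ℕ, k = n ∧ ExistsSyntRigid L M n}.Nonempty := by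
    by_contra hcon
    exact h (by rw [degExistsSynt, not_nonempty_iff_eq_empty.1 hcon, sInf_empty])
  obtain ⟨n, hn, A, hA, hd⟩ := csInf_mem hne
  exact ⟨A, hA.trans hn.symm, hd⟩

theorem degExistsSynt_ne_zero (h : dcl L (∅ : Set M) ≠ univ) : degExistsSynt L M ≠ 0 := by
  intro h0
  obtain ⟨A, hA, hd⟩ := exists_encard_eq_degExistsSynt (L := L) (M := M) (by simp [h0])
  rw [h0, encard_eq_zero] at hA
  exact h (hA ▸ hd)

end Degree

/-! ### Relations of the composition -/

section Composition

variable {S : ℕ → Type u} {SM SN : ∀ n, Set (S n)} {M : Type v} {N : Type w}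

theorem relMap_iff_rel {Sg : ∀ n, Set (S n)} {X : Type v} [(relLang Sg).Structure X] {n : ℕ}
    (R : (relLang Sg).Relations n) (x : Fin n → X) :
    Structure.RelMap R x ↔ rel Sg R.1 x :=
  ⟨fun h => ⟨R.2, h⟩, fun ⟨_, h⟩ => h⟩

theorem definable_rel {Sg : ∀ n, Set (S n)} {X : Type v} [(relLang Sg).Structure X] {n : ℕ}
    (R : S n) : (∅ : Set X).Definable (relLang Sg) {x : Fin n → X | rel Sg R x} := by
  by_cases hR : R ∈ Sg n
  · convert definable_relMap (L := relLang Sg) (K := X) (n := n) ⟨R, hR⟩ using 3 with x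
    exact (relMap_iff_rel (Sg := Sg) ⟨R, hR⟩ x).symm
  · simp [rel, hR]

theorem definable_forall_eq {L : FirstOrder.Language.{u, v}} {K : Type*} [L.Structure K]
    {r : K → K → Prop} (hr : (∅ : Set K).Definable₂ L {p | r p.1 p.2}) (n : ℕ) :
    (∅ : Set K).Definable L {x : Fin n → K | ∀ i j, r (x i) (x j)} := by
  have : {x : Fin n → K | ∀ i j, r (x i) (x j)} =
      ⋂ q : Fin n × Fin n, (fun x : Fin n → K => x ∘ ![q.1, q.2]) ⁻¹'
        {x : Fin 2 → K | (x 0, x 1) ∈ {p : K × K | r p.1 p.2}} := by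
    ext x
    simp
  rw [this]
  exact definable_iInter_of_finite fun q => hr.preimage_comp _

variable [(relLang SM).Structure M] [(relLang SN).Structure N]

theorem rel_union_iff {n : ℕ} (R : S n) (x : Fin n → M × N) :
    rel (unionSymb SM SN) R x ↔ rel SM R (fun i => (x i).1) ∨
      ((∀ i j, (x i).1 = (x j).1) ∧ rel SN R (fun i => (x i).2)) := by
  refine ⟨fun ⟨_, h⟩ => h, fun h => ?_⟩
  have hR : R ∈ unionSymb SM SN n := h.elim (fun h => Or.inl h.1) (fun h => Or.inr h.2.1)
  exact ⟨hR, h⟩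

/-! ### Lower bounds: projections and fibers of a generating set -/

/-- Second coordinates are frozen, so a parameter of `A` acts on `M` only through its first
coordinate. -/
theorem dcl_image_fst [Nonempty N] {A : Set (M × N)}
    (hA : dcl (relLang (unionSymb SM SN)) A = univ) :
    dcl (relLang SM) (Prod.fst '' A) = univ := by
  refine eq_univ_of_forall fun a => ?_
  obtain ⟨b⟩ := ‹Nonempty N›
  obtain ⟨s, hs, h⟩ := mem_dcl_iff.1 (hA ▸ mem_univ (a, b))
  let θ : A ⊕ Fin 1 → N := Sum.elim (fun p => p.1.2) fun _ => b
  have hD := definable_fiber (L := relLang (unionSymb SM SN)) (L' := relLang SM)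
    (fun (b : N) (a : M) => (a, b)) (fun x => ⟨x.2, x.1, rfl⟩) ?_ ?_ hs θ
  · refine mem_dcl_of_definable (definable_subst hD (Sum.map
      (fun p : A => ⟨p.1.1, mem_image_of_mem Prod.fst p.2⟩) id)) fun y => ?_
    have : (fun i : A ⊕ Fin 1 => ((Sum.elim (fun p : (Prod.fst '' A : Set M) => (p : M)) y ∘
        Sum.map (fun p : A => ⟨p.1.1, mem_image_of_mem Prod.fst p.2⟩) id) i, θ i)) =
        Sum.elim (fun p : A => (p : M × N)) (fun i => (y i, b)) := by
      funext i
      rcases i with i | i <;> rfl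
    simp only [mem_ofPred_eq, this, h, Prod.mk.injEq, and_true]
  · refine FinDefFamily.of_mem (G := {{y | y 0 = y 1}, ∅}) (toFinite _) ?_ fun θ => ?_
    · rintro _ (rfl | rfl)
      · exact definable_eq _ _ _
      · exact definable_empty
    · by_cases hθ : θ 0 = θ 1 <;> simp [hθ]
  · intro n R
    -- The frozen second coordinates matter only through whether they satisfy `R` in `N`; if they
    -- do, the constant tuples of `M` are added.
    refine FinDefFamily.of_mem (G := {{y | rel SM R.1 y},
      {y | rel SM R.1 y} ∪ {y | ∀ i j, y i = y j}}) (toFinite _) ?_ fun θ => ?_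
    · rintro _ (rfl | rfl)
      · exact definable_rel _
      · exact (definable_rel _).union (definable_forall_eq (Definable.diagonal _ _) n)
    · by_cases hθ : rel SN R.1 θ
      · right
        ext y
        simp [relMap_iff_rel, rel_union_iff, hθ]
      · left
        ext y
        simp [relMap_iff_rel, rel_union_iff, hθ]

/-- Only the points of the class of `a` move, each along its second coordinate. All other points are
frozen entirely, so parameters outside that class can be discarded. -/
theorem dcl_fiber_snd {A : Set (M × N)} (hA : dcl (relLang (unionSymb SM SN)) A = univ) (a : M) :
    dcl (relLang SN) {b : N | (a, b) ∈ A} = univ := by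
  classical
  refine eq_univ_of_forall fun b => ?_
  obtain ⟨s, hs, h⟩ := mem_dcl_iff.1 (hA ▸ mem_univ (a, b))
  let T : M × N → N → M × N := fun x y => if x.1 = a then (a, y) else x
  have hT1 : ∀ x y, (T x y).1 = x.1 := by
    intro x y
    by_cases hx : x.1 = a <;> simp [T, hx]
  let θ : A ⊕ Fin 1 → M × N := Sum.elim (fun p => p.1) fun _ => (a, b)
  -- `Sum.inr 0` is a dummy for parameters outside the class of `a`, since `T` ignores its second
  -- argument there.
  let g : A ⊕ Fin 1 → {b : N | (a, b) ∈ A} ⊕ Fin 1 := Sum.elim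
    (fun p => if hp : p.1.1 = a then Sum.inl ⟨p.1.2, by rw [← hp]; exact p.2⟩ else Sum.inr 0) Sum.inr
  have hD := definable_fiber (L := relLang (unionSymb SM SN)) (L' := relLang SN)
    T (fun x => ⟨x, x.2, ?_⟩) ?_ ?_ hs θ
  · refine mem_dcl_of_definable (definable_subst hD g) fun y => ?_
    have : (fun i : A ⊕ Fin 1 => T (θ i)
        ((Sum.elim (fun p : {b : N | (a, b) ∈ A} => (p : N)) y ∘ g) i)) =
        Sum.elim (fun p : A => (p : M × N)) (fun i => (a, y i)) := by
      funext i
      rcases i with i | i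
      · by_cases hi : i.1.1 = a
        · simp only [T, θ, g, Sum.elim_inl, Function.comp_apply, hi, dif_pos, if_pos]
          exact Prod.ext hi.symm rfl
        · simp [T, θ, hi]
      · simp [T, θ, g]
    simp only [mem_ofPred_eq, this, h, Prod.mk.injEq, true_and]
  · by_cases hx : x.1 = a
    · simp only [T, hx, if_pos]
      exact Prod.ext hx.symm rfl
    · simp [T, hx]
  · refine FinDefFamily.of_mem (G := {{y | y 0 = y 1}, ∅, univ}) (toFinite _) ?_ fun θ => ?_
    · rintro _ (rfl | rfl | rfl)
      · exact definable_eq _ _ _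
      · exact definable_empty
      · exact definable_univ
    · by_cases h0 : (θ 0).1 = a <;> by_cases h1 : (θ 1).1 = a
      · left
        ext y
        simp [T, h0, h1]
      · right; left
        ext y
        simp only [T, h0, h1, if_true, if_false, mem_ofPred_eq, mem_empty_iff_false, iff_false]
        exact fun he => h1 (congrArg Prod.fst he).symm
      · right; left
        ext y
        simp only [T, h0, h1, if_true, if_false, mem_ofPred_eq, mem_empty_iff_false, iff_false]
        exact fun he => h0 (congrArg Prod.fst he)
      · by_cases he : θ 0 = θ 1
        · right; right
          ext y
          simp [T, h1, he]
        · right; left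
          ext y
          simp [T, h0, h1, he]
  · intro n R
    refine FinDefFamily.of_mem (G := {{y | rel SN R.1 y}, ∅, univ}) (toFinite _) ?_ fun θ => ?_
    · rintro _ (rfl | rfl | rfl)
      · exact definable_rel _
      · exact definable_empty
      · exact definable_univ
    · have hmem : ∀ y : Fin n → N, Structure.RelMap R (fun i => T (θ i) (y i)) ↔
          rel SM R.1 (fun i => (θ i).1) ∨ ((∀ i j, (θ i).1 = (θ j).1) ∧
            rel SN R.1 (fun i => (T (θ i) (y i)).2)) := by
        intro y
        simp only [relMap_iff_rel, rel_union_iff, hT1]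
      simp only [hmem]
      by_cases hM : rel SM R.1 (fun i => (θ i).1)
      · right; right
        simp [hM]
      · by_cases hc : ∀ i j, (θ i).1 = (θ j).1
        · by_cases ha : ∀ i, (θ i).1 = a
          · left
            ext y
            simp only [hM, false_or, mem_ofPred_eq]
            simp [T, ha]
          · obtain ⟨i, hi⟩ := not_forall.1 ha
            have ha' : ∀ j, (θ j).1 ≠ a := fun j hj => hi ((hc i j).trans hj)
            right
            by_cases hN : rel SN R.1 (fun i => (θ i).2)
            · right
              ext y
              simpa [hM, T, ha', hN] using hc
            · left
              ext y
              simp [hM, T, ha', hN]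
        · right; left
          ext y
          simp only [hM, hc, false_and, or_false, mem_ofPred_eq, mem_empty_iff_false]

/-! ### Upper bounds: generating sets built from the factors -/

theorem IsEDefinableComposition.definable_fst_eq (hE : IsEDefinableComposition SM SN M N) :
    (∅ : Set (M × N)).Definable₂ (relLang (unionSymb SM SN)) {p | p.1.1 = p.2.1} := by
  obtain ⟨⟨E, hdef, hcl⟩, -⟩ := hE
  refine (congrArg (Set.Definable₂ ∅ _) (Set.ext fun p => ?_)).mpr hdef
  have hcls : {x | E x p.2} = {q : M × N | q.1 = p.2.1} := by
    have h : {x | E x p.2} ∈ E.classes := ⟨p.2, rfl⟩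
    rw [hcl] at h
    obtain ⟨a, ha⟩ := h
    have h2 : p.2 ∈ {x | E x p.2} := E.refl _
    rw [← ha] at h2 ⊢
    have h2 : p.2.1 = a := h2
    rw [h2]
  exact (Set.ext_iff.1 hcls p.1).symm

/-- A symbol of `M` can acquire extra tuples in the composition only if it is shared, and then only
inside a single class. There `hdiag` says that its value in `M` is always true or always false, so
adding or removing the tuples inside one class recovers it. -/
theorem exists_definable_fst [Nonempty M] [Nonempty N] (hE : IsEDefinableComposition SM SN M N)
    (hdiag : SharedSymbolsDiagonal SM SN M) {β : Type*} (z : β) {t : Set (β → M)}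
    (ht : (∅ : Set M).Definable (relLang SM) t) :
    ∃ s : Set (β → M × N), (∅ : Set (M × N)).Definable (relLang (unionSymb SM SN)) s ∧
      ∀ x, x ∈ s ↔ Prod.fst ∘ x ∈ t := by
  have hrel : ∀ (n : ℕ) (R : (relLang SM).Relations n), ∃ s : Set (Fin n → M × N),
      (∅ : Set (M × N)).Definable (relLang (unionSymb SM SN)) s ∧
      ∀ z x, (∀ i, (fun _ _ : M × N => True) z (x i)) →
        (x ∈ s ↔ Structure.RelMap R (Prod.fst ∘ x)) := by
    intro n R
    have hconst := definable_forall_eq (r := fun p q : M × N => p.1 = q.1) hE.definable_fst_eq n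
    by_cases hR : R.1 ∈ SN n
    · have hc : ∀ x : Fin n → M × N, (∀ i j, (x i).1 = (x j).1) →
          ∃ a : M, (fun i => (x i).1) = fun _ => a := by
        intro x hx
        rcases n with _ | n
        -- For arity 0 the empty tuple is constant with any value, so a point of `M` has to be
        -- supplied.
        · exact ⟨Classical.arbitrary M, Subsingleton.elim _ _⟩
        · exact ⟨(x 0).1, funext fun i => hx i 0⟩
      rcases hdiag n R.1 R.2 hR with hall | hnone
      · refine ⟨_, (definable_rel R.1).union hconst, fun _ x _ => ?_⟩
        simp only [mem_union, mem_ofPred_eq, rel_union_iff, relMap_iff_rel]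
        refine ⟨?_, fun h => Or.inl (Or.inl h)⟩
        have hx : (∀ i j, (x i).1 = (x j).1) → rel SM R.1 (fun i => (x i).1) := by
          intro hx
          obtain ⟨a, ha⟩ := hc x hx
          exact ha ▸ hall a
        rintro ((h | h) | h)
        · exact h
        · exact hx h.1
        · exact hx h
      · refine ⟨_, (definable_rel R.1).sdiff hconst, fun _ x _ => ?_⟩
        simp only [mem_sdiff, mem_ofPred_eq, rel_union_iff, relMap_iff_rel]
        refine ⟨fun h => h.1.resolve_right fun h' => h.2 h'.1, fun h => ⟨Or.inl h, fun hx => ?_⟩⟩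
        obtain ⟨a, ha⟩ := hc x hx
        exact hnone a (ha ▸ h)
    · refine ⟨_, definable_rel R.1, fun _ x _ => ?_⟩
      have : ∀ x : Fin n → N, ¬ rel SN R.1 x := fun x h => hR h.1
      simp only [mem_ofPred_eq, rel_union_iff, relMap_iff_rel, this, and_false, or_false]
      rfl
  obtain ⟨s, hs, h⟩ := exists_definable_pullback_set (L := relLang (unionSymb SM SN))
    (Prod.fst : M × N → M) (fun _ _ => True) definable_univ
    (fun _ a => ⟨(a, Classical.arbitrary N), trivial, rfl⟩)
    ⟨_, hE.definable_fst_eq, fun _ _ _ => Iff.rfl⟩ hrel z ht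
  exact ⟨s, hs, fun x => h x fun _ => trivial⟩

theorem exists_definable_snd (hE : IsEDefinableComposition SM SN M N)
    {β : Type*} (z : β) {t : Set (β → N)} (ht : (∅ : Set N).Definable (relLang SN) t) :
    ∃ s : Set (β → M × N), (∅ : Set (M × N)).Definable (relLang (unionSymb SM SN)) s ∧
      ∀ x, (∀ i, (x z).1 = (x i).1) → (x ∈ s ↔ Prod.snd ∘ x ∈ t) := by
  refine exists_definable_pullback_set (L := relLang (unionSymb SM SN))
    (Prod.snd : M × N → N) (fun p q => p.1 = q.1) hE.definable_fst_eq
    (fun p b => ⟨(p.1, b), rfl, rfl⟩)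
    ⟨_, definable_eq _ 0 1, fun p x hx => ?_⟩ ?_ z ht
  · exact ⟨fun h => congrArg Prod.snd h, fun h => Prod.ext ((hx 0).symm.trans (hx 1)) h⟩
  · intro n R
    refine ⟨_, definable_rel R.1, fun p x hx => ?_⟩
    have : x = fun i => (p.1, (x i).2) := funext fun i => Prod.ext (hx i).symm rfl
    rw [mem_ofPred_eq, relMap_iff_rel, this]
    exact hE.2 p.1 n R.1 R.2 _

/-- The formula for `a` over `A` pins down the class, and the parameter-free formula for `b`,
relativized to the class of the variable itself, pins down the point. The value `c` plays no role.
-/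
theorem dcl_prod_singleton [Nonempty M] [Nonempty N] (hE : IsEDefinableComposition SM SN M N)
    (hdiag : SharedSymbolsDiagonal SM SN M) (hN : dcl (relLang SN) (∅ : Set N) = univ)
    {A : Set M} (hA : dcl (relLang SM) A = univ) (c : N) :
    dcl (relLang (unionSymb SM SN)) (A ×ˢ ({c} : Set N)) = univ := by
  refine eq_univ_of_forall fun ⟨a, b⟩ => ?_
  let e : A → A ×ˢ ({c} : Set N) := fun p => ⟨(p.1, c), p.2, rfl⟩
  obtain ⟨t, ht, hat⟩ := mem_dcl_iff.1 (hA ▸ mem_univ a)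
  have hb : (∅ : Set N).Definable (relLang SN) {y : Fin 1 → N | y 0 ∈ ({b} : Set N)} :=
    show b ∈ dcl (relLang SN) (∅ : Set N) from hN ▸ mem_univ b
  obtain ⟨s, hs, hst⟩ := exists_definable_fst hE hdiag (Sum.inr 0) ht
  obtain ⟨s', hs', hst'⟩ := exists_definable_snd hE 0 hb
  refine mem_dcl_of_definable ((definable_subst hs
    (Sum.map e id)).inter
      (hs'.mono (empty_subset _))) fun y => ?_
  have : Prod.fst ∘ Sum.elim (fun p : A ×ˢ ({c} : Set N) => (p : M × N)) y ∘
      Sum.map e id =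
      Sum.elim (fun p : A => (p : M)) fun i => (y i).1 := by
    funext i
    rcases i with i | i <;> rfl
  rw [mem_inter_iff, mem_ofPred_eq, hst, this, hat,
    hst' y fun i => congrArg (fun j => (y j).1) (Subsingleton.elim 0 i)]
  exact (Prod.ext_iff (x := y 0) (y := (a, b))).symm

/-- The parameter `(a, c)` names the class of `a`; inside it, the copy of `A` defines `b`. -/
theorem dcl_univ_prod (hE : IsEDefinableComposition SM SN M N) {A : Set N} (hne : A.Nonempty)
    (hA : dcl (relLang SN) A = univ) :
    dcl (relLang (unionSymb SM SN)) ((univ : Set M) ×ˢ A) = univ := by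
  refine eq_univ_of_forall fun ⟨a, b⟩ => ?_
  obtain ⟨c, hc⟩ := hne
  let e : A → (univ : Set M) ×ˢ A := fun p => ⟨(a, p.1), mem_univ _, p.2⟩
  obtain ⟨t, ht, hbt⟩ := mem_dcl_iff.1 (hA ▸ mem_univ b)
  obtain ⟨s, hs, hst⟩ := exists_definable_snd hE (Sum.inr 0) ht
  refine mem_dcl_of_definable ((definable_subst hs
    (Sum.map e id)).inter
      (definable_subst hE.definable_fst_eq
        ![Sum.inl (e ⟨c, hc⟩), Sum.inr 0])) fun y => ?_
  have hy : y ∈ {y : Fin 1 → M × N | Sum.elim (fun p : (univ : Set M) ×ˢ A => (p : M × N)) y ∘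
      ![Sum.inl (e ⟨c, hc⟩), Sum.inr 0] ∈
        {x : Fin 2 → M × N | (x 0, x 1) ∈ {p : (M × N) × (M × N) | p.1.1 = p.2.1}}} ↔
      a = (y 0).1 := by simp [e]
  rw [mem_inter_iff, hy]
  -- The pulled-back set `s` is controlled only on tuples lying in one class, hence the hypothesis.
  have hyb : a = (y 0).1 → (Sum.elim (fun p : (univ : Set M) ×ˢ A => (p : M × N)) y ∘
      Sum.map e id ∈ s ↔ (y 0).2 = b) := by
    intro ha
    rw [hst, ← hbt fun i => (y i).2]
    · refine iff_of_eq (congrArg (· ∈ t) (funext fun i => ?_))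
      rcases i with i | i <;> rfl
    · rintro (i | i)
      · exact ha.symm
      · rw [Subsingleton.elim i 0]
  rw [mem_ofPred_eq, Prod.ext_iff]
  exact ⟨fun h => ⟨h.2.symm, (hyb h.2).1 h.1⟩, fun h => ⟨(hyb h.1.symm).2 h.2, h.1.symm⟩⟩

/-! ### The two degree formulas -/

theorem degExistsSynt_comp_of_dcl_eq_univ [Nonempty M] [Nonempty N]
    (hE : IsEDefinableComposition SM SN M N) (hdiag : SharedSymbolsDiagonal SM SN M)
    (hN : dcl (relLang SN) (∅ : Set N) = univ) :
    degExistsSynt (relLang (unionSymb SM SN)) (M × N) = degExistsSynt (relLang SM) M := by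
  refine le_antisymm (le_degExistsSynt fun A _ hA => ?_) (le_degExistsSynt fun A _ hA => ?_)
  · refine (degExistsSynt_le_encard
      (dcl_prod_singleton hE hdiag hN hA (Classical.arbitrary N))).trans ?_
    rw [encard_prod, encard_singleton, mul_one]
  · exact (degExistsSynt_le_encard (dcl_image_fst hA)).trans (encard_image_le _ _)

theorem card_mul_degExistsSynt_le (hN : dcl (relLang SN) (∅ : Set N) ≠ univ) :
    ENat.card M * degExistsSynt (relLang SN) N ≤
      degExistsSynt (relLang (unionSymb SM SN)) (M × N) := by
  refine le_degExistsSynt fun A hfin hA => ?_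
  have hsurj : Prod.fst '' A = univ := by
    refine eq_univ_of_forall fun a => ?_
    have hne : {b : N | (a, b) ∈ A}.Nonempty := by
      rw [nonempty_iff_ne_empty]
      exact fun h => hN (h ▸ dcl_fiber_snd hA a)
    obtain ⟨b, hb⟩ := hne
    exact ⟨(a, b), hb, rfl⟩
  -- Every fiber is nonempty because the empty set does not generate `N`, so a finite `A` projects
  -- onto all of `M`.
  have : Finite M := finite_univ_iff.1 (hsurj ▸ hfin.image _)
  have := Fintype.ofFinite M
  have hunion : A = ⋃ a : M, Prod.mk a '' {b : N | (a, b) ∈ A} := by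
    ext ⟨a, b⟩
    simp
  rw [hunion, encard_iUnion_of_finite, finsum_eq_sum_of_fintype, ENat.card_eq_coe_fintype_card,
    ← nsmul_eq_mul, Fintype.card]
  · refine Finset.card_nsmul_le_sum _ _ _ fun a _ => ?_
    rw [(Prod.mk_right_injective a).encard_image]
    exact degExistsSynt_le_encard (dcl_fiber_snd hA a)
  · intro a a' haa'
    refine disjoint_left.2 ?_
    rintro _ ⟨b, -, rfl⟩ ⟨b', -, h⟩
    exact haa' (congrArg Prod.fst h).symm

theorem degExistsSynt_comp_of_dcl_ne_univ [Nonempty M]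
    (hE : IsEDefinableComposition SM SN M N) (hN : dcl (relLang SN) (∅ : Set N) ≠ univ) :
    degExistsSynt (relLang (unionSymb SM SN)) (M × N) =
      ENat.card M * degExistsSynt (relLang SN) N := by
  refine le_antisymm ?_ (card_mul_degExistsSynt_le hN)
  by_cases htop : degExistsSynt (relLang SN) N = ⊤
  -- Nonemptiness of `M` excludes the product `0 * ⊤ = 0`.
  · rw [htop, ENat.mul_top (by simp)]
    exact le_top
  · obtain ⟨A, hcard, hA⟩ := exists_encard_eq_degExistsSynt htop
    have hne : A.Nonempty := by
      rw [nonempty_iff_ne_empty]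
      exact fun h => hN (h ▸ hA)
    refine (degExistsSynt_le_encard (dcl_univ_prod hE hne hA)).trans ?_
    rw [encard_prod, encard_univ, hcard]

end Composition

end Rigidity

theorem mainTheorem7 {S : ℕ → Type u} (SM SN : ∀ n, Set (S n))
    (M : Type v) (N : Type w) [Nonempty M] [Nonempty N]
    [(Rigidity.relLang SM).Structure M] [(Rigidity.relLang SN).Structure N]
    (hE : Rigidity.IsEDefinableComposition SM SN M N) :
    (Rigidity.dcl (Rigidity.relLang SN) (∅ : Set N) = Set.univ →
      Rigidity.SharedSymbolsDiagonal SM SN M →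
        Rigidity.degExistsSynt (Rigidity.relLang (Rigidity.unionSymb SM SN)) (M × N) =
            Rigidity.degExistsSynt (Rigidity.relLang SM) M ∧
        (Rigidity.degExistsSynt (Rigidity.relLang (Rigidity.unionSymb SM SN)) (M × N) ≠ ⊤ ↔
          Rigidity.degExistsSynt (Rigidity.relLang SM) M ≠ ⊤)) ∧
    (Rigidity.dcl (Rigidity.relLang SN) (∅ : Set N) ≠ Set.univ →
        Rigidity.degExistsSynt (Rigidity.relLang (Rigidity.unionSymb SM SN)) (M × N) =
            ENat.card M * Rigidity.degExistsSynt (Rigidity.relLang SN) N ∧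
        (Rigidity.degExistsSynt (Rigidity.relLang (Rigidity.unionSymb SM SN)) (M × N) ≠ ⊤ ↔
          Rigidity.degExistsSynt (Rigidity.relLang SN) N ≠ ⊤ ∧ Finite M)) := by
  refine ⟨fun hN hdiag => ?_, fun hN => ?_⟩
  · rw [Rigidity.degExistsSynt_comp_of_dcl_eq_univ hE hdiag hN]
    exact ⟨rfl, Iff.rfl⟩
  · have h0 := Rigidity.degExistsSynt_ne_zero hN
    have hM : ENat.card M ≠ 0 := by simp
    rw [Rigidity.degExistsSynt_comp_of_dcl_ne_univ hE hN]
    refine ⟨rfl, ?_⟩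
    rw [← ENat.card_lt_top, lt_top_iff_ne_top]
    constructor
    · refine fun h => ⟨fun h' => h ?_, fun h' => h ?_⟩
      · rw [h', ENat.mul_top hM]
      · rw [h', ENat.top_mul h0]
    · exact fun h => WithTop.mul_ne_top h.2 h.1
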